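/- Theorem (ODE for $\sigma_3$). Let $\theta_3(x)=\sum_{n=-\infty}^{\infty}e^{-\pi n^2x}$ for complex $x$ with $\operatorname{Re}x>0$, and let $$\sigma_3(z)=\frac{1}{\sqrt{1+z}}\,\theta_3\!\left(\frac{1-z}{1+z}\right)\qquad(z\in\mathbb C,\ |z|<1),$$ where the square root is the principal branch. Then $\sigma_3$ is holomorphic on the open unit disk, and $y=\sigma_3(z)$ satisfies, at every point $z$ with $|z|<1$, the nonlinear third-order ordinary differential equation $$\bigl(y^2y'''-15\,y\,y'\,y''+30\,(y')^3\bigr)^2+32\,\bigl(y\,y''-3\,(y')^2\bigr)^3=4\pi^2y^{10}\bigl(y\,y''-3\,(y')^2\bigr)^2,$$ where primes denote complex derivatives with respect to $z$. -/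

import Mathlib

/-- The Jacobi theta constant `θ₃(x) = ∑_{n ∈ ℤ} exp (-π n² x)`, for `Re x > 0`. -/
noncomputable def theta3 (x : ℂ) : ℂ :=
  ∑' n : ℤ, Complex.exp (-(Real.pi : ℂ) * (n : ℂ) ^ 2 * x)

/-- The centered theta constant `σ₃(z) = (1 + z)^(-1/2) θ₃((1 - z) / (1 + z))`, for `|z| < 1`,
where the square root is the principal one (note `Re (1 + z) > 0`). -/
noncomputable def sigma3 (z : ℂ) : ℂ :=
  1 / (1 + z) ^ (1 / 2 : ℂ) * theta3 ((1 - z) / (1 + z))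

/-! The ODE comes from a Halphen system. On the upper half plane, the logarithmic derivatives of θ₂,
θ₃, θ₄ satisfy `deriv_ellTwo`, `deriv_ellThree` and `deriv_ellFour`. The system is covariant under
Möbius maps, so the Cayley transform carries it to the disk, where σ₃'/σ₃ is one of the three
components (`hasDerivAt_diskLogDeriv`, `hasDerivAt_sigma3`). Differentiating σ₃ then gives
polynomials in the components, and the ODE reduces to a relation between the other two components
and σ₃⁸ (`jacobi_ode_of_halphen`, `diskLogDeriv_sub_sq`).

The theta identities behind the system follow from one principle: a level one form of weight below
12 that tends to 0 at i∞ is zero (`eq_zero_of_levelOne`). It gives Jacobi's quartic identity, the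
differences of logarithmic derivatives as multiples of θ⁴ (`defect_eq_zero`), and the derivative of
their sum (`deriv_ell_sum`). Differentiating the differences supplies the remaining two equations of
the system. Division by theta constants is legitimate because (θ₂θ₃θ₄)⁸ is a nonzero multiple of the
discriminant. -/

open Filter Topology

/-! ### Level one cusp forms and limits at i∞ -/

/-- The filter of points of the complex plane with imaginary part tending to infinity. -/
def imInfty : Filter ℂ := comap Complex.im atTop

theorem tendsto_coe_imInfty : Tendsto ((↑) : UpperHalfPlane → ℂ) UpperHalfPlane.atImInfty imInfty :=
  tendsto_comap_iff.mpr tendsto_comap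

theorem tendsto_im_imInfty : Tendsto (fun τ : ℂ ↦ τ.im) imInfty atTop := tendsto_comap

theorem isOpen_upper : IsOpen {τ : ℂ | 0 < τ.im} :=
  isOpen_lt continuous_const Complex.continuous_im

theorem im_neg_one_div_pos {τ : ℂ} (hτ : 0 < τ.im) : 0 < (-1 / τ).im := by
  have := UpperHalfPlane.im_inv_neg_coe_pos ⟨τ, hτ⟩
  simpa [neg_div, inv_neg] using this

theorem ne_zero_of_im_pos {τ : ℂ} (hτ : 0 < τ.im) : τ ≠ 0 := by
  rintro rfl
  simp at hτ

open scoped MatrixGroups ModularForm in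
/-- A holomorphic function on the upper half plane which transforms under the generators of the
modular group like a form of weight `k` and tends to zero at `i∞` is a cusp form. -/
theorem exists_cuspForm {k : ℤ} {f : ℂ → ℂ} (hd : DifferentiableOn ℂ f {τ | 0 < τ.im})
    (hT : ∀ τ : ℂ, 0 < τ.im → f (τ + 1) = f τ)
    (hS : ∀ τ : ℂ, 0 < τ.im → f (-1 / τ) = τ ^ k * f τ)
    (h0 : Tendsto f imInfty (𝓝 0)) :
    ∃ F : CuspForm 𝒮ℒ k, ∀ τ : UpperHalfPlane, F τ = f τ := by
  have hS' : (fun τ : UpperHalfPlane ↦ f τ) ∣[k] ModularGroup.S = fun τ : UpperHalfPlane ↦ f τ := by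
    ext z
    rw [SlashInvariantForm.slash_S_apply]
    have h := hS z z.im_pos
    simp only [neg_div, one_div] at h
    simp only [inv_neg, h]
    rw [mul_right_comm, ← zpow_add₀ z.ne_zero]
    simp
  have hT' : (fun τ : UpperHalfPlane ↦ f τ) ∣[k] ModularGroup.T = fun τ : UpperHalfPlane ↦ f τ := by
    ext z
    rw [ModularForm.SL_slash_apply, UpperHalfPlane.modular_T_smul]
    have hden : UpperHalfPlane.denom ModularGroup.T z = 1 := by
      rw [ModularGroup.denom_apply]
      simp [ModularGroup.T]
    rw [hden]
    simp [← hT z z.im_pos, add_comm]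
  have hinv := SlashInvariantForm.slash_action_generators_SL2Z hS' hT'
  refine ⟨{ toFun := fun τ ↦ f τ
            slash_action_eq' := fun _ ⟨γ, hγ⟩ ↦ hγ ▸ hinv γ
            holo' := ?_
            zero_at_cusps' := ?_ }, fun τ ↦ rfl⟩
  · rw [UpperHalfPlane.mdifferentiable_iff]
    refine hd.congr fun τ hτ ↦ ?_
    simp [UpperHalfPlane.ofComplex_apply_of_im_pos hτ]
  · intro c hc
    -- All cusps are equivalent under SL₂(ℤ), and `f` is invariant under the slash action, so the
    -- limit at i∞ suffices.
    rw [OnePoint.isZeroAt_iff_forall_SL2Z hc]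
    intro γ _
    refine Tendsto.congr (fun τ ↦ ?_) (h0.comp tendsto_coe_imInfty)
    exact (congrFun (hinv γ) τ).symm

/-- Level one cusp forms of weight less than `12` vanish. -/
theorem eq_zero_of_levelOne {k : ℤ} (hk : k < 12) {f : ℂ → ℂ}
    (hd : DifferentiableOn ℂ f {τ | 0 < τ.im})
    (hT : ∀ τ : ℂ, 0 < τ.im → f (τ + 1) = f τ)
    (hS : ∀ τ : ℂ, 0 < τ.im → f (-1 / τ) = τ ^ k * f τ)
    (h0 : Tendsto f imInfty (𝓝 0)) {τ : ℂ} (hτ : 0 < τ.im) : f τ = 0 := by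
  obtain ⟨F, hF⟩ := exists_cuspForm hd hT hS h0
  have := rank_zero_iff_forall_zero.mp (CuspForm.rank_eq_zero_of_weight_lt_twelve hk) F
  rw [← hF ⟨τ, hτ⟩, this]
  rfl

/-- If `f` is holomorphic on the upper half plane and has a limit at `i∞`, its derivative tends
to zero there. -/
theorem tendsto_deriv_imInfty {f : ℂ → ℂ} (hd : DifferentiableOn ℂ f {τ | 0 < τ.im}) {c : ℂ}
    (h0 : Tendsto f imInfty (𝓝 c)) : Tendsto (deriv f) imInfty (𝓝 0) := by
  rw [Metric.tendsto_nhds]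
  intro ε hε
  have h := Metric.tendsto_nhds.mp h0 (ε / 2) (half_pos hε)
  rw [imInfty, eventually_comap, eventually_atTop] at h ⊢
  obtain ⟨M, hM⟩ := h
  -- The margin 2 keeps the closed unit disk about `τ` inside the half plane and above height `M`;
  -- Cauchy's estimate for `f - c` on it gives the bound.
  refine ⟨max M 0 + 2, fun b hb τ hτ ↦ ?_⟩
  have hle : ∀ w ∈ Metric.closedBall τ 1, max M 0 + 1 ≤ w.im := by
    intro w hw
    have h1 := (Complex.abs_im_le_norm (w - τ)).trans (mem_closedBall_iff_norm.mp hw)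
    rw [Complex.sub_im, abs_le] at h1
    linarith [h1.1]
  have hpos : ∀ w ∈ Metric.closedBall τ 1, 0 < w.im := fun w hw ↦ by
    linarith [hle w hw, le_max_right M 0]
  have key : ‖deriv (fun w ↦ f w - c) τ‖ ≤ (ε / 2) / 1 := by
    refine Complex.norm_deriv_le_of_forall_mem_sphere_norm_le one_pos ?_ fun w hw ↦ ?_
    · refine DifferentiableOn.diffContOnCl ?_
      rw [closure_ball _ one_ne_zero]
      exact (hd.mono hpos).sub_const c
    · have hw' := Metric.sphere_subset_closedBall hw
      have := hM w.im (by linarith [hle w hw', le_max_left M 0]) w rfl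
      rw [dist_eq_norm] at this
      exact this.le
  rw [deriv_sub_const] at key
  rw [dist_zero_right]
  linarith

/-! ### The theta constants -/

/-- The factor `∑ exp (π i n (n + 1) τ)` of the theta constant `θ₂`. -/
noncomputable def thetaH (τ : ℂ) : ℂ := jacobiTheta₂ (τ / 2) τ

/-- The theta constant `θ₂`. -/
noncomputable def thetaTwo (τ : ℂ) : ℂ := Complex.exp (Real.pi * Complex.I / 4 * τ) * thetaH τ

/-- The theta constant `θ₃`. -/
noncomputable def thetaThree (τ : ℂ) : ℂ := jacobiTheta₂ 0 τ

/-- The theta constant `θ₄`. -/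
noncomputable def thetaFour (τ : ℂ) : ℂ := jacobiTheta₂ (1 / 2) τ

theorem jacobiTheta₂_add_one (z τ : ℂ) : jacobiTheta₂ z (τ + 1) = jacobiTheta₂ (z + 1 / 2) τ := by
  refine tsum_congr fun n ↦ ?_
  simp only [jacobiTheta₂_term]
  rw [Complex.exp_eq_exp_iff_exists_int]
  -- Since n² ≡ n mod 2, the factor exp(πi n²) equals exp(πi n), which is a shift of `z` by 1/2.
  obtain ⟨m, hm⟩ : Even (n * (n - 1)) := Int.even_mul_pred_self n
  refine ⟨m, ?_⟩
  have hm' : (n : ℂ) * (n - 1) = m + m := by exact_mod_cast hm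
  linear_combination Real.pi * Complex.I * hm'

theorem thetaThree_add_one (τ : ℂ) : thetaThree (τ + 1) = thetaFour τ := by
  simp [thetaThree, thetaFour, jacobiTheta₂_add_one]

theorem thetaFour_add_one (τ : ℂ) : thetaFour (τ + 1) = thetaThree τ := by
  rw [thetaThree, thetaFour, jacobiTheta₂_add_one, ← jacobiTheta₂_add_left 0]
  norm_num

theorem thetaH_add_one (τ : ℂ) : thetaH (τ + 1) = thetaH τ := by
  rw [thetaH, thetaH, jacobiTheta₂_add_one, ← jacobiTheta₂_add_left (τ / 2)]
  ring_nf

theorem thetaTwo_add_one_pow (τ : ℂ) : thetaTwo (τ + 1) ^ 4 = -thetaTwo τ ^ 4 := by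
  have h : Complex.exp (Real.pi * Complex.I / 4 * (τ + 1)) ^ 4
      = -Complex.exp (Real.pi * Complex.I / 4 * τ) ^ 4 := by
    rw [← Complex.exp_nat_mul, ← Complex.exp_nat_mul, ← mul_neg_one, ← Complex.exp_pi_mul_I,
      ← Complex.exp_add]
    congr 1
    push_cast
    ring
  rw [thetaTwo, thetaTwo, thetaH_add_one, mul_pow, mul_pow, h]
  ring

/-- Fourth powers remove the square root from the functional equation; this is why the theta
transformation laws for -1/τ are stated for fourth powers. -/
theorem neg_I_mul_cpow_pow_four (τ : ℂ) :
    ((-Complex.I * τ) ^ (1 / 2 : ℂ)) ^ 4 = -τ ^ 2 := by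
  rw [← Complex.cpow_nat_mul]
  norm_num
  rw [mul_pow, Complex.I_sq]
  ring

theorem thetaThree_inv_pow {τ : ℂ} (hτ : 0 < τ.im) :
    thetaThree (-1 / τ) ^ 4 = -τ ^ 2 * thetaThree τ ^ 4 := by
  have h := jacobiTheta₂_functional_equation 0 τ
  have h0 := ne_zero_of_im_pos hτ
  have h1 := neg_I_mul_cpow_pow_four τ
  rw [thetaThree, thetaThree, h, mul_pow, mul_pow, div_pow, h1]
  simp
  field_simp

theorem thetaTwo_inv_pow {τ : ℂ} (hτ : 0 < τ.im) :
    thetaTwo (-1 / τ) ^ 4 = -τ ^ 2 * thetaFour τ ^ 4 := by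
  have h := jacobiTheta₂_functional_equation (1 / 2) τ
  have h0 := ne_zero_of_im_pos hτ
  have h1 := neg_I_mul_cpow_pow_four τ
  have h2 : jacobiTheta₂ (1 / 2 / τ) (-1 / τ) = thetaH (-1 / τ) := by
    rw [thetaH, ← jacobiTheta₂_neg_left]
    congr 1
    ring
  have h3 : -(Real.pi : ℂ) * Complex.I * (1 / 2) ^ 2 / τ
      = Real.pi * Complex.I / 4 * (-1 / τ) := by ring
  rw [h2, h3, mul_assoc] at h
  rw [thetaFour, h, thetaTwo, mul_pow (1 / _), div_pow, h1]
  field_simp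

theorem thetaFour_inv_pow {τ : ℂ} (hτ : 0 < τ.im) :
    thetaFour (-1 / τ) ^ 4 = -τ ^ 2 * thetaTwo τ ^ 4 := by
  have h := thetaTwo_inv_pow (im_neg_one_div_pos hτ)
  have h0 := ne_zero_of_im_pos hτ
  have h1 : -1 / (-1 / τ) = τ := by field_simp
  rw [h1] at h
  rw [h]
  field_simp

theorem differentiableAt_thetaThree {τ : ℂ} (hτ : 0 < τ.im) : DifferentiableAt ℂ thetaThree τ :=
  differentiableAt_jacobiTheta₂_snd 0 hτ

theorem differentiableAt_thetaFour {τ : ℂ} (hτ : 0 < τ.im) : DifferentiableAt ℂ thetaFour τ :=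
  differentiableAt_jacobiTheta₂_snd (1 / 2) hτ

theorem differentiableAt_thetaH {τ : ℂ} (hτ : 0 < τ.im) : DifferentiableAt ℂ thetaH τ := by
  have h := (hasFDerivAt_jacobiTheta₂ (τ / 2) hτ).differentiableAt
  have h2 : DifferentiableAt ℂ (fun t : ℂ ↦ (t / 2, t)) τ := by fun_prop
  exact DifferentiableAt.comp (g := fun p : ℂ × ℂ ↦ jacobiTheta₂ p.1 p.2)
    (f := fun t : ℂ ↦ (t / 2, t)) τ h h2

theorem differentiableAt_thetaTwo {τ : ℂ} (hτ : 0 < τ.im) : DifferentiableAt ℂ thetaTwo τ := by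
  have := differentiableAt_thetaH hτ
  unfold thetaTwo
  fun_prop

theorem tendsto_add_one_imInfty : Tendsto (fun τ : ℂ ↦ τ + 1) imInfty imInfty := by
  refine tendsto_comap_iff.mpr ?_
  simpa [Function.comp_def] using tendsto_im_imInfty

theorem tendsto_exp_imInfty {r : ℝ} (hr : 0 < r) :
    Tendsto (fun τ : ℂ ↦ Complex.exp (Real.pi * Complex.I * r * τ)) imInfty (𝓝 0) := by
  rw [tendsto_zero_iff_norm_tendsto_zero]
  have h : ∀ τ : ℂ, ‖Complex.exp (Real.pi * Complex.I * r * τ)‖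
      = Real.exp (-(Real.pi * r * τ.im)) := by
    intro τ
    rw [Complex.norm_exp]
    simp
  simp only [h]
  refine Real.tendsto_exp_neg_atTop_nhds_zero.comp ?_
  exact Tendsto.const_mul_atTop (by positivity) tendsto_im_imInfty

theorem tendsto_thetaThree : Tendsto thetaThree imInfty (𝓝 1) := by
  have h1 : Tendsto (fun τ : ℂ ↦ Real.exp (-Real.pi * τ.im)) imInfty (𝓝 0) := by
    simp only [neg_mul]
    exact Real.tendsto_exp_neg_atTop_nhds_zero.comp
      (tendsto_im_imInfty.const_mul_atTop Real.pi_pos)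
  have h := isBigO_at_im_infty_jacobiTheta_sub_one.trans_tendsto h1
  have h2 := h.add_const 1
  simp only [sub_add_cancel, zero_add] at h2
  exact h2.congr fun τ ↦ jacobiTheta_eq_jacobiTheta₂ τ

theorem tendsto_thetaFour : Tendsto thetaFour imInfty (𝓝 1) :=
  (tendsto_thetaThree.comp tendsto_add_one_imInfty).congr thetaThree_add_one

/-- The exponents n(n + 1) are nonnegative and vanish only for n = 0 and n = -1, so two terms equal
to 1 survive. The terms at τ = i dominate once Im τ ≥ 1. -/
theorem tendsto_thetaH : Tendsto thetaH imInfty (𝓝 2) := by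
  have hterm : ∀ (n : ℤ) (τ : ℂ), jacobiTheta₂_term n (τ / 2) τ
      = Complex.exp (Real.pi * Complex.I * ((n * (n + 1) : ℤ) : ℝ) * τ) := by
    intro n τ
    rw [jacobiTheta₂_term]
    congr 1
    push_cast
    ring
  have hnn : ∀ n : ℤ, 0 ≤ n * (n + 1) := by
    intro n
    rcases le_or_gt 0 n with h | h
    · positivity
    · nlinarith
  have hlim : ∑' n : ℤ, (if n ∈ ({0, -1} : Finset ℤ) then (1 : ℂ) else 0) = 2 := by
    rw [tsum_eq_sum (s := {0, -1}) (by intro b hb; simp_all)]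
    rw [Finset.sum_pair (by norm_num)]
    norm_num
  rw [← hlim]
  have hsum : Summable fun n : ℤ ↦ ‖jacobiTheta₂_term n (Complex.I / 2) Complex.I‖ :=
    ((summable_jacobiTheta₂_term_iff _ _).mpr (by simp)).norm
  refine tendsto_tsum_of_dominated_convergence hsum (fun n ↦ ?_) ?_
  · simp only [hterm]
    split_ifs with h
    · have : n * (n + 1) = 0 := by
        simp only [Finset.mem_insert, Finset.mem_singleton] at h
        rcases h with rfl | rfl <;> norm_num
      simpa [this] using tendsto_const_nhds
    · refine tendsto_exp_imInfty ?_
      have h1 : n * (n + 1) ≠ 0 := by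
        simp only [Finset.mem_insert, Finset.mem_singleton, not_or] at h
        exact mul_ne_zero h.1 (by omega)
      exact_mod_cast lt_of_le_of_ne (hnn n) h1.symm
  · have h1 : ∀ᶠ τ : ℂ in imInfty, 1 ≤ τ.im := tendsto_comap.eventually_ge_atTop 1
    filter_upwards [h1] with τ hτ n
    rw [hterm, hterm, Complex.norm_exp, Complex.norm_exp, Real.exp_le_exp]
    have : (0 : ℝ) ≤ ((n * (n + 1) : ℤ) : ℝ) := by exact_mod_cast hnn n
    have h2 : 0 ≤ Real.pi * ((n * (n + 1) : ℤ) : ℝ) * (τ.im - 1) :=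
      mul_nonneg (mul_nonneg Real.pi_pos.le this) (by linarith)
    simp only [Complex.mul_re, Complex.mul_im, Complex.ofReal_re, Complex.ofReal_im, Complex.I_re,
      Complex.I_im]
    nlinarith

theorem tendsto_thetaTwo : Tendsto thetaTwo imInfty (𝓝 0) := by
  have h := (tendsto_exp_imInfty (r := 1 / 4) (by norm_num)).mul tendsto_thetaH
  rw [zero_mul] at h
  refine h.congr fun τ ↦ ?_
  rw [thetaTwo]
  congr 2
  push_cast
  ring

/-- The eighth power of the product is a cusp form of weight 12, hence a multiple of the
discriminant, which has no zeros. -/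
theorem thetaTwo_thetaThree_thetaFour_ne_zero {τ : ℂ} (hτ : 0 < τ.im) :
    thetaTwo τ ≠ 0 ∧ thetaThree τ ≠ 0 ∧ thetaFour τ ≠ 0 := by
  have pow8 : ∀ {a b c : ℂ}, a ^ 4 = c * b ^ 4 → a ^ 8 = c ^ 2 * b ^ 8 := by
    intro a b c h
    linear_combination (a ^ 4 + c * b ^ 4) * h
  obtain ⟨F, hF⟩ := exists_cuspForm (k := 12)
    (f := fun τ ↦ thetaTwo τ ^ 8 * thetaThree τ ^ 8 * thetaFour τ ^ 8)
    (fun τ (hτ : 0 < τ.im) ↦ by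
      have h2 := differentiableAt_thetaTwo hτ
      have h3 := differentiableAt_thetaThree hτ
      have h4 := differentiableAt_thetaFour hτ
      exact DifferentiableAt.differentiableWithinAt (by fun_prop))
    (fun τ _ ↦ by
      simp only [thetaThree_add_one, thetaFour_add_one]
      linear_combination thetaFour τ ^ 8 * thetaThree τ ^ 8 *
        (thetaTwo (τ + 1) ^ 4 - thetaTwo τ ^ 4) * thetaTwo_add_one_pow τ)
    (fun τ hτ ↦ by
      simp only [pow8 (thetaTwo_inv_pow hτ), pow8 (thetaThree_inv_pow hτ),
        pow8 (thetaFour_inv_pow hτ)]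
      norm_cast
      ring)
    (by simpa using ((tendsto_thetaTwo.pow 8).mul (tendsto_thetaThree.pow 8)).mul
          (tendsto_thetaFour.pow 8))
  obtain ⟨c, hc⟩ := CuspForm.exists_smul_discriminant_of_weight_eq_twelve F
  have hF' : ∀ τ : UpperHalfPlane, thetaTwo τ ^ 8 * thetaThree τ ^ 8 * thetaFour τ ^ 8
      = c * ModularForm.discriminant τ := by
    intro τ
    rw [← hF, ← hc]
    rfl
  -- With c = 0 the product would vanish identically, but without the exponential factor of θ₂ it
  -- tends to 2.
  have hc0 : c ≠ 0 := by
    rintro rfl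
    have hlim := (((tendsto_thetaH.mul tendsto_thetaThree).mul
      tendsto_thetaFour).comp tendsto_coe_imInfty).eventually_ne
      (b₂ := 0) (by norm_num)
    obtain ⟨τ, hτ⟩ := hlim.exists
    apply hτ
    have := hF' τ
    rw [zero_mul, ← mul_pow, ← mul_pow, pow_eq_zero_iff (by norm_num), thetaTwo] at this
    simpa [Complex.exp_ne_zero] using this
  have h := mul_ne_zero hc0 (ModularForm.discriminant_ne_zero ⟨τ, hτ⟩)
  rw [← hF'] at h
  simpa [and_assoc] using h

/-- Jacobi's identity `θ₃⁴ = θ₂⁴ + θ₄⁴`. -/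
theorem thetaThree_pow_four {τ : ℂ} (hτ : 0 < τ.im) :
    thetaThree τ ^ 4 = thetaTwo τ ^ 4 + thetaFour τ ^ 4 := by
  have h := eq_zero_of_levelOne (k := 4) (by norm_num)
    -- The unsquared difference changes sign under τ ↦ τ + 1; its square is invariant.
    (f := fun τ ↦ (thetaThree τ ^ 4 - thetaTwo τ ^ 4 - thetaFour τ ^ 4) ^ 2)
    (fun τ (hτ : 0 < τ.im) ↦ by
      have h2 := differentiableAt_thetaTwo hτ
      have h3 := differentiableAt_thetaThree hτ
      have h4 := differentiableAt_thetaFour hτ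
      exact DifferentiableAt.differentiableWithinAt (by fun_prop))
    (fun τ _ ↦ by
      simp only [thetaThree_add_one, thetaFour_add_one, thetaTwo_add_one_pow]
      ring)
    (fun τ hτ ↦ by
      simp only [thetaTwo_inv_pow hτ, thetaThree_inv_pow hτ, thetaFour_inv_pow hτ]
      norm_cast
      ring)
    (by simpa using (((tendsto_thetaThree.pow 4).sub (tendsto_thetaTwo.pow 4)).sub
          (tendsto_thetaFour.pow 4)).pow 2) hτ
  linear_combination pow_eq_zero_iff (two_ne_zero) |>.mp h

/-! ### Transformation of logarithmic derivatives -/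

theorem logDeriv_add_one_of_pow_four {f g : ℂ → ℂ} {e τ : ℂ} (he : e ≠ 0)
    (h : ∀ t, f (t + 1) ^ 4 = e * g t ^ 4) (hf : DifferentiableAt ℂ f (τ + 1))
    (hg : DifferentiableAt ℂ g τ) (hg0 : g τ ≠ 0) :
    logDeriv f (τ + 1) = logDeriv g τ := by
  have h1 : HasDerivAt (fun t ↦ f (t + 1) ^ 4) _ τ := (hf.hasDerivAt.comp_add_const τ 1).pow 4
  have h2 : HasDerivAt (fun t ↦ e * g t ^ 4) _ τ := (hg.hasDerivAt.pow 4).const_mul e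
  have h3 := h1.unique (by rwa [funext h])
  have h4 := h τ
  have hf0 : f (τ + 1) ≠ 0 := by
    refine (pow_ne_zero_iff (n := 4) (by norm_num)).mp ?_
    rw [h4]
    exact mul_ne_zero he (pow_ne_zero 4 hg0)
  rw [logDeriv_apply, logDeriv_apply, div_eq_div_iff hf0 hg0]
  simp only [Nat.reduceSub, Nat.cast_ofNat] at h3
  refine mul_left_cancel₀ (pow_ne_zero 3 hf0) ?_
  linear_combination g τ / 4 * h3 - deriv g τ * h4

theorem hasDerivAt_neg_one_div {τ : ℂ} (hτ : τ ≠ 0) :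
    HasDerivAt (fun t : ℂ ↦ -1 / t) (1 / τ ^ 2) τ := by
  have := (hasDerivAt_inv hτ).neg
  refine (this.congr_deriv (by field_simp)).congr_of_eventuallyEq ?_
  exact Eventually.of_forall fun t ↦ by simp [neg_div]

/-- Logarithmic differentiation of the hypothesis: the factor -t² contributes 2/τ, which becomes the
anomaly τ/2 after multiplication by τ²/4. -/
theorem logDeriv_neg_one_div_of_pow_four {f g : ℂ → ℂ} {τ : ℂ} (hτ : 0 < τ.im)
    (h : ∀ t : ℂ, 0 < t.im → f (-1 / t) ^ 4 = -t ^ 2 * g t ^ 4)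
    (hf : DifferentiableAt ℂ f (-1 / τ)) (hg : DifferentiableAt ℂ g τ) (hg0 : g τ ≠ 0) :
    logDeriv f (-1 / τ) = τ ^ 2 * logDeriv g τ + τ / 2 := by
  have hτ0 := ne_zero_of_im_pos hτ
  have h1 : HasDerivAt (fun t ↦ f (-1 / t) ^ 4) _ τ :=
    (hf.hasDerivAt.comp τ (hasDerivAt_neg_one_div hτ0)).pow 4
  have h2 : HasDerivAt (fun t : ℂ ↦ -t ^ 2 * g t ^ 4) _ τ :=
    ((hasDerivAt_pow 2 τ).neg).mul (hg.hasDerivAt.pow 4)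
  have h3 := h1.unique (h2.congr_of_eventuallyEq
    (Filter.eventually_of_mem (isOpen_upper.mem_nhds hτ) h))
  have h4 := h τ hτ
  have hf0 : f (-1 / τ) ≠ 0 := by
    refine (pow_ne_zero_iff (n := 4) (by norm_num)).mp ?_
    rw [h4]
    exact mul_ne_zero (neg_ne_zero.mpr (pow_ne_zero 2 hτ0)) (pow_ne_zero 4 hg0)
  rw [logDeriv_apply, logDeriv_apply]
  simp only [Nat.reduceSub, Nat.cast_ofNat, pow_one, Pi.neg_apply, Function.comp_apply] at h3
  generalize f (-1 / τ) = X at *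
  generalize deriv f (-1 / τ) = D at *
  field_simp at h3 ⊢
  refine mul_left_cancel₀ (pow_ne_zero 3 hf0) ?_
  linear_combination (g τ / 2) * h3 - τ * (2 * τ * deriv g τ + g τ) * h4

theorem deriv_add_one_of_eqOn {f g : ℂ → ℂ} {τ : ℂ} (hτ : 0 < τ.im)
    (h : ∀ t : ℂ, 0 < t.im → f (t + 1) = g t) : deriv f (τ + 1) = deriv g τ := by
  rw [← deriv_comp_add_const]
  exact Filter.EventuallyEq.deriv_eq (Filter.eventually_of_mem (isOpen_upper.mem_nhds hτ) h)

theorem deriv_neg_one_div_of_eqOn {f g : ℂ → ℂ} {τ : ℂ} (hτ : 0 < τ.im)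
    (h : ∀ t : ℂ, 0 < t.im → f (-1 / t) = t ^ 2 * g t + t / 2)
    (hf : DifferentiableAt ℂ f (-1 / τ)) (hg : DifferentiableAt ℂ g τ) :
    deriv f (-1 / τ) = τ ^ 4 * deriv g τ + 2 * τ ^ 3 * g τ + τ ^ 2 / 2 := by
  have hτ0 := ne_zero_of_im_pos hτ
  have h1 : HasDerivAt (fun t ↦ f (-1 / t)) _ τ :=
    hf.hasDerivAt.comp τ (hasDerivAt_neg_one_div hτ0)
  have h2 : HasDerivAt (fun t : ℂ ↦ t ^ 2 * g t + t / 2) _ τ :=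
    ((hasDerivAt_pow 2 τ).mul hg.hasDerivAt).add ((hasDerivAt_id τ).div_const 2)
  have h3 := h1.unique (h2.congr_of_eventuallyEq
    (Filter.eventually_of_mem (isOpen_upper.mem_nhds hτ) h))
  simp only [Nat.reduceSub, Nat.cast_ofNat, pow_one] at h3
  generalize deriv f (-1 / τ) = D at *
  field_simp at h3
  linear_combination h3 / 2

theorem differentiableOn_logDeriv {f : ℂ → ℂ} {s : Set ℂ} (hs : IsOpen s)
    (hf : DifferentiableOn ℂ f s) (h0 : ∀ z ∈ s, f z ≠ 0) :
    DifferentiableOn ℂ (logDeriv f) s :=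
  (hf.deriv hs).div hf h0

/-! ### Logarithmic derivatives of the theta constants -/

/-- The logarithmic derivative of `θ₂`. -/
noncomputable def ellTwo : ℂ → ℂ := logDeriv thetaTwo

/-- The logarithmic derivative of `θ₃`. -/
noncomputable def ellThree : ℂ → ℂ := logDeriv thetaThree

/-- The logarithmic derivative of `θ₄`. -/
noncomputable def ellFour : ℂ → ℂ := logDeriv thetaFour

theorem differentiableOn_ellTwo : DifferentiableOn ℂ ellTwo {τ | 0 < τ.im} :=
  differentiableOn_logDeriv isOpen_upper
    (fun _ hτ ↦ (differentiableAt_thetaTwo hτ).differentiableWithinAt)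
    fun _ hτ ↦ (thetaTwo_thetaThree_thetaFour_ne_zero hτ).1

theorem differentiableOn_ellThree : DifferentiableOn ℂ ellThree {τ | 0 < τ.im} :=
  differentiableOn_logDeriv isOpen_upper
    (fun _ hτ ↦ (differentiableAt_thetaThree hτ).differentiableWithinAt)
    fun _ hτ ↦ (thetaTwo_thetaThree_thetaFour_ne_zero hτ).2.1

theorem differentiableOn_ellFour : DifferentiableOn ℂ ellFour {τ | 0 < τ.im} :=
  differentiableOn_logDeriv isOpen_upper
    (fun _ hτ ↦ (differentiableAt_thetaFour hτ).differentiableWithinAt)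
    fun _ hτ ↦ (thetaTwo_thetaThree_thetaFour_ne_zero hτ).2.2

theorem differentiableAt_ellTwo {τ : ℂ} (hτ : 0 < τ.im) : DifferentiableAt ℂ ellTwo τ :=
  differentiableOn_ellTwo.differentiableAt (isOpen_upper.mem_nhds hτ)

theorem differentiableAt_ellThree {τ : ℂ} (hτ : 0 < τ.im) : DifferentiableAt ℂ ellThree τ :=
  differentiableOn_ellThree.differentiableAt (isOpen_upper.mem_nhds hτ)

theorem differentiableAt_ellFour {τ : ℂ} (hτ : 0 < τ.im) : DifferentiableAt ℂ ellFour τ :=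
  differentiableOn_ellFour.differentiableAt (isOpen_upper.mem_nhds hτ)

theorem im_add_one_pos {τ : ℂ} (hτ : 0 < τ.im) : 0 < (τ + 1).im := by simpa using hτ

theorem ellTwo_add_one {τ : ℂ} (hτ : 0 < τ.im) : ellTwo (τ + 1) = ellTwo τ :=
  logDeriv_add_one_of_pow_four (e := -1) (by norm_num)
    (fun t ↦ by rw [thetaTwo_add_one_pow]; ring)
    (differentiableAt_thetaTwo (im_add_one_pos hτ)) (differentiableAt_thetaTwo hτ)
    (thetaTwo_thetaThree_thetaFour_ne_zero hτ).1

theorem ellThree_add_one {τ : ℂ} (hτ : 0 < τ.im) : ellThree (τ + 1) = ellFour τ :=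
  logDeriv_add_one_of_pow_four (e := 1) (by norm_num)
    (fun t ↦ by rw [thetaThree_add_one]; ring)
    (differentiableAt_thetaThree (im_add_one_pos hτ)) (differentiableAt_thetaFour hτ)
    (thetaTwo_thetaThree_thetaFour_ne_zero hτ).2.2

theorem ellFour_add_one {τ : ℂ} (hτ : 0 < τ.im) : ellFour (τ + 1) = ellThree τ :=
  logDeriv_add_one_of_pow_four (e := 1) (by norm_num)
    (fun t ↦ by rw [thetaFour_add_one]; ring)
    (differentiableAt_thetaFour (im_add_one_pos hτ)) (differentiableAt_thetaThree hτ)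
    (thetaTwo_thetaThree_thetaFour_ne_zero hτ).2.1

theorem ellTwo_neg_one_div {τ : ℂ} (hτ : 0 < τ.im) :
    ellTwo (-1 / τ) = τ ^ 2 * ellFour τ + τ / 2 :=
  logDeriv_neg_one_div_of_pow_four hτ (fun _ ht ↦ thetaTwo_inv_pow ht)
    (differentiableAt_thetaTwo (im_neg_one_div_pos hτ)) (differentiableAt_thetaFour hτ)
    (thetaTwo_thetaThree_thetaFour_ne_zero hτ).2.2

theorem ellThree_neg_one_div {τ : ℂ} (hτ : 0 < τ.im) :
    ellThree (-1 / τ) = τ ^ 2 * ellThree τ + τ / 2 :=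
  logDeriv_neg_one_div_of_pow_four hτ (fun _ ht ↦ thetaThree_inv_pow ht)
    (differentiableAt_thetaThree (im_neg_one_div_pos hτ)) (differentiableAt_thetaThree hτ)
    (thetaTwo_thetaThree_thetaFour_ne_zero hτ).2.1

theorem ellFour_neg_one_div {τ : ℂ} (hτ : 0 < τ.im) :
    ellFour (-1 / τ) = τ ^ 2 * ellTwo τ + τ / 2 :=
  logDeriv_neg_one_div_of_pow_four hτ (fun _ ht ↦ thetaFour_inv_pow ht)
    (differentiableAt_thetaFour (im_neg_one_div_pos hτ)) (differentiableAt_thetaTwo hτ)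
    (thetaTwo_thetaThree_thetaFour_ne_zero hτ).1

theorem tendsto_logDeriv_imInfty {f : ℂ → ℂ} {c : ℂ} (hc : c ≠ 0)
    (hd : DifferentiableOn ℂ f {τ | 0 < τ.im}) (h : Tendsto f imInfty (𝓝 c)) :
    Tendsto (logDeriv f) imInfty (𝓝 0) := by
  simpa using! (tendsto_deriv_imInfty hd h).div h hc

theorem tendsto_ellThree : Tendsto ellThree imInfty (𝓝 0) :=
  tendsto_logDeriv_imInfty one_ne_zero
    (fun _ hτ ↦ (differentiableAt_thetaThree hτ).differentiableWithinAt) tendsto_thetaThree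

theorem tendsto_ellFour : Tendsto ellFour imInfty (𝓝 0) :=
  tendsto_logDeriv_imInfty one_ne_zero
    (fun _ hτ ↦ (differentiableAt_thetaFour hτ).differentiableWithinAt) tendsto_thetaFour

/-- The exponential prefactor of θ₂ contributes πi/4, and the factor `thetaH` contributes nothing in
the limit. -/
theorem tendsto_ellTwo : Tendsto ellTwo imInfty (𝓝 (Real.pi * Complex.I / 4)) := by
  have h := (tendsto_logDeriv_imInfty two_ne_zero
    (fun _ hτ ↦ (differentiableAt_thetaH hτ).differentiableWithinAt) tendsto_thetaH).const_add
    (Real.pi * Complex.I / 4 : ℂ)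
  rw [add_zero] at h
  refine h.congr' ?_
  filter_upwards [tendsto_im_imInfty.eventually_gt_atTop 0] with τ hτ
  have h0 := (thetaTwo_thetaThree_thetaFour_ne_zero hτ).1
  rw [thetaTwo] at h0
  have h1 : HasDerivAt (fun t : ℂ ↦ Complex.exp (Real.pi * Complex.I / 4 * t)) _ τ :=
    ((hasDerivAt_id τ).const_mul (Real.pi * Complex.I / 4 : ℂ)).cexp
  have h2 : HasDerivAt thetaTwo _ τ := h1.mul (differentiableAt_thetaH hτ).hasDerivAt
  rw [ellTwo, logDeriv_apply, logDeriv_apply, h2.deriv, thetaTwo]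
  have h3 := right_ne_zero_of_mul h0
  have h4 := left_ne_zero_of_mul h0
  simp only [id_eq] at *
  field_simp

/-! ### Differences of logarithmic derivatives -/

/-- Algebraic elimination: a tangent vector at `(A, B, A + B)` killed by the differentials of the
invariants of degrees two and three is zero, away from the discriminant. -/
theorem eq_zero_of_invariant_differentials {A B a b : ℂ} (hA : A ≠ 0) (hB : B ≠ 0)
    (hC : A + B ≠ 0) (h4 : A * a + B * b + (A + B) * (a + b) = 0)
    (h6 : (2 * a + b) * (A + 2 * B) * (A - B) + (2 * A + B) * (a + 2 * b) * (A - B)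
      + (2 * A + B) * (A + 2 * B) * (a - b) = 0) : a = 0 ∧ b = 0 := by
  -- Up to sign, 27AB(A + B) is the determinant of the linear system in (a, b); Cramer's rule gives
  -- the combinations below.
  have hdet := mul_ne_zero (mul_ne_zero (mul_ne_zero (by norm_num : (27 : ℂ) ≠ 0) hA) hB) hC
  constructor <;> refine (mul_eq_zero.mp ?_).resolve_left hdet
  · linear_combination (A + 2 * B) * h6 - ((A + 2 * B) * (A - B) + 2 * (2 * A + B) * (A - B)
      - (2 * A + B) * (A + 2 * B)) * h4
  · linear_combination (2 * (A + 2 * B) * (A - B) + (2 * A + B) * (A - B)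
      + (2 * A + B) * (A + 2 * B)) * h4 - (2 * A + B) * h6

/-- The defect in the relation between `θ₄⁴` and the logarithmic derivatives. -/
noncomputable def defectFour (τ : ℂ) : ℂ :=
  ellTwo τ - ellThree τ - Real.pi * Complex.I / 4 * thetaFour τ ^ 4

/-- The defect in the relation between `θ₂⁴` and the logarithmic derivatives. -/
noncomputable def defectTwo (τ : ℂ) : ℂ :=
  ellThree τ - ellFour τ - Real.pi * Complex.I / 4 * thetaTwo τ ^ 4

theorem differentiableAt_defectFour {τ : ℂ} (hτ : 0 < τ.im) : DifferentiableAt ℂ defectFour τ := by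
  have h4 := differentiableAt_thetaFour hτ
  have h5 := differentiableAt_ellTwo hτ
  have h6 := differentiableAt_ellThree hτ
  unfold defectFour
  fun_prop

theorem differentiableAt_defectTwo {τ : ℂ} (hτ : 0 < τ.im) : DifferentiableAt ℂ defectTwo τ := by
  have h2 := differentiableAt_thetaTwo hτ
  have h5 := differentiableAt_ellFour hτ
  have h6 := differentiableAt_ellThree hτ
  unfold defectTwo
  fun_prop

/-- The pair (`defectFour`, `defectTwo`) transforms exactly like (θ₄⁴, θ₂⁴), because the anomalies
τ/2 cancel in differences. -/
theorem defectFour_add_one {τ : ℂ} (hτ : 0 < τ.im) :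
    defectFour (τ + 1) = defectFour τ + defectTwo τ := by
  rw [defectFour, ellTwo_add_one hτ, ellThree_add_one hτ, thetaFour_add_one,
    thetaThree_pow_four hτ, defectFour, defectTwo]
  ring

theorem defectTwo_add_one {τ : ℂ} (hτ : 0 < τ.im) : defectTwo (τ + 1) = -defectTwo τ := by
  rw [defectTwo, ellFour_add_one hτ, ellThree_add_one hτ, thetaTwo_add_one_pow, defectTwo]
  ring

theorem defectFour_neg_one_div {τ : ℂ} (hτ : 0 < τ.im) :
    defectFour (-1 / τ) = -τ ^ 2 * defectTwo τ := by
  rw [defectFour, ellTwo_neg_one_div hτ, ellThree_neg_one_div hτ, thetaFour_inv_pow hτ, defectTwo]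
  ring

theorem defectTwo_neg_one_div {τ : ℂ} (hτ : 0 < τ.im) :
    defectTwo (-1 / τ) = -τ ^ 2 * defectFour τ := by
  rw [defectTwo, ellFour_neg_one_div hτ, ellThree_neg_one_div hτ, thetaTwo_inv_pow hτ, defectFour]
  ring

theorem tendsto_defectFour : Tendsto defectFour imInfty (𝓝 0) := by
  simpa using! (tendsto_ellTwo.sub tendsto_ellThree).sub
    ((tendsto_thetaFour.pow 4).const_mul (Real.pi * Complex.I / 4 : ℂ))

theorem tendsto_defectTwo : Tendsto defectTwo imInfty (𝓝 0) := by
  simpa using! (tendsto_ellThree.sub tendsto_ellFour).sub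
    ((tendsto_thetaTwo.pow 4).const_mul (Real.pi * Complex.I / 4 : ℂ))

/-- With A = θ₄⁴ and B = θ₂⁴, this is half the differential of the invariant A² + B² + (A + B)²,
evaluated on the defects, so it is a level one form. -/
theorem defect_weight_four {τ : ℂ} (hτ : 0 < τ.im) :
    thetaFour τ ^ 4 * defectFour τ + thetaTwo τ ^ 4 * defectTwo τ
      + (thetaFour τ ^ 4 + thetaTwo τ ^ 4) * (defectFour τ + defectTwo τ) = 0 := by
  refine eq_zero_of_levelOne (k := 4) (by norm_num)
    (f := fun τ ↦ thetaFour τ ^ 4 * defectFour τ + thetaTwo τ ^ 4 * defectTwo τ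
      + (thetaFour τ ^ 4 + thetaTwo τ ^ 4) * (defectFour τ + defectTwo τ))
    (fun τ (hτ : 0 < τ.im) ↦ ?_) (fun τ hτ ↦ ?_) (fun τ hτ ↦ ?_) ?_ hτ
  · have h2 := differentiableAt_thetaTwo hτ
    have h4 := differentiableAt_thetaFour hτ
    have h5 := differentiableAt_defectTwo hτ
    have h6 := differentiableAt_defectFour hτ
    exact DifferentiableAt.differentiableWithinAt (by fun_prop)
  · simp only [thetaFour_add_one, thetaTwo_add_one_pow, defectFour_add_one hτ,
      defectTwo_add_one hτ, thetaThree_pow_four hτ]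
    ring
  · simp only [thetaTwo_inv_pow hτ, thetaFour_inv_pow hτ, defectFour_neg_one_div hτ,
      defectTwo_neg_one_div hτ]
    norm_cast
    ring
  · have h4 := tendsto_thetaFour.pow 4
    have h2 := tendsto_thetaTwo.pow 4
    simpa using ((h4.mul tendsto_defectFour).add (h2.mul tendsto_defectTwo)).add
      ((h4.add h2).mul (tendsto_defectFour.add tendsto_defectTwo))

/-- The same argument, with the cubic invariant (2A + B)(A + 2B)(A - B). -/
theorem defect_weight_six {τ : ℂ} (hτ : 0 < τ.im) :
    (2 * defectFour τ + defectTwo τ) * (thetaFour τ ^ 4 + 2 * thetaTwo τ ^ 4)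
        * (thetaFour τ ^ 4 - thetaTwo τ ^ 4)
      + (2 * thetaFour τ ^ 4 + thetaTwo τ ^ 4) * (defectFour τ + 2 * defectTwo τ)
        * (thetaFour τ ^ 4 - thetaTwo τ ^ 4)
      + (2 * thetaFour τ ^ 4 + thetaTwo τ ^ 4) * (thetaFour τ ^ 4 + 2 * thetaTwo τ ^ 4)
        * (defectFour τ - defectTwo τ) = 0 := by
  refine eq_zero_of_levelOne (k := 6) (by norm_num)
    (f := fun τ ↦ (2 * defectFour τ + defectTwo τ) * (thetaFour τ ^ 4 + 2 * thetaTwo τ ^ 4)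
        * (thetaFour τ ^ 4 - thetaTwo τ ^ 4)
      + (2 * thetaFour τ ^ 4 + thetaTwo τ ^ 4) * (defectFour τ + 2 * defectTwo τ)
        * (thetaFour τ ^ 4 - thetaTwo τ ^ 4)
      + (2 * thetaFour τ ^ 4 + thetaTwo τ ^ 4) * (thetaFour τ ^ 4 + 2 * thetaTwo τ ^ 4)
        * (defectFour τ - defectTwo τ))
    (fun τ (hτ : 0 < τ.im) ↦ ?_) (fun τ hτ ↦ ?_) (fun τ hτ ↦ ?_) ?_ hτ
  · have h2 := differentiableAt_thetaTwo hτ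
    have h4 := differentiableAt_thetaFour hτ
    have h5 := differentiableAt_defectTwo hτ
    have h6 := differentiableAt_defectFour hτ
    exact DifferentiableAt.differentiableWithinAt (by fun_prop)
  · simp only [thetaFour_add_one, thetaTwo_add_one_pow, defectFour_add_one hτ,
      defectTwo_add_one hτ, thetaThree_pow_four hτ]
    ring
  · simp only [thetaTwo_inv_pow hτ, thetaFour_inv_pow hτ, defectFour_neg_one_div hτ,
      defectTwo_neg_one_div hτ]
    norm_cast
    ring
  · have hA := tendsto_thetaFour.pow 4
    have hB := tendsto_thetaTwo.pow 4
    have ha := tendsto_defectFour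
    have hb := tendsto_defectTwo
    have hα := (hA.const_mul 2).add hB
    have hβ := hA.add (hB.const_mul 2)
    have hγ := hA.sub hB
    simpa using ((((ha.const_mul 2).add hb).mul hβ).mul hγ).add
      ((hα.mul (ha.add (hb.const_mul 2))).mul hγ) |>.add ((hα.mul hβ).mul (ha.sub hb))

theorem defect_eq_zero {τ : ℂ} (hτ : 0 < τ.im) : defectFour τ = 0 ∧ defectTwo τ = 0 := by
  obtain ⟨h2, h3, h4⟩ := thetaTwo_thetaThree_thetaFour_ne_zero hτ
  refine eq_zero_of_invariant_differentials (pow_ne_zero 4 h4) (pow_ne_zero 4 h2) ?_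
    (defect_weight_four hτ) (defect_weight_six hτ)
  rw [add_comm, ← thetaThree_pow_four hτ]
  exact pow_ne_zero 4 h3

theorem ellTwo_sub_ellThree {τ : ℂ} (hτ : 0 < τ.im) :
    ellTwo τ - ellThree τ = Real.pi * Complex.I / 4 * thetaFour τ ^ 4 :=
  sub_eq_zero.mp (defect_eq_zero hτ).1

theorem ellThree_sub_ellFour {τ : ℂ} (hτ : 0 < τ.im) :
    ellThree τ - ellFour τ = Real.pi * Complex.I / 4 * thetaTwo τ ^ 4 :=
  sub_eq_zero.mp (defect_eq_zero hτ).2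

theorem ellTwo_sub_ellFour {τ : ℂ} (hτ : 0 < τ.im) :
    ellTwo τ - ellFour τ = Real.pi * Complex.I / 4 * thetaThree τ ^ 4 := by
  rw [thetaThree_pow_four hτ]
  linear_combination ellTwo_sub_ellThree hτ + ellThree_sub_ellFour hτ

/-! ### The Halphen system -/

theorem deriv_sub_of_eq_const_mul_pow_four {f g h : ℂ → ℂ} {c τ : ℂ} (hτ : 0 < τ.im)
    (hf : DifferentiableAt ℂ f τ) (hg : DifferentiableAt ℂ g τ) (hh : DifferentiableAt ℂ h τ)
    (heq : ∀ t : ℂ, 0 < t.im → f t - g t = c * h t ^ 4) :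
    deriv f τ - deriv g τ = 4 * (f τ - g τ) * logDeriv h τ := by
  have h1 : HasDerivAt (fun t ↦ f t - g t) _ τ := hf.hasDerivAt.sub hg.hasDerivAt
  have h2 : HasDerivAt (fun t ↦ c * h t ^ 4) _ τ := (hh.hasDerivAt.pow 4).const_mul c
  have h3 := h1.unique (h2.congr_of_eventuallyEq
    (Filter.eventually_of_mem (isOpen_upper.mem_nhds hτ) heq))
  rw [h3, heq τ hτ, logDeriv_apply]
  field_simp
  norm_num
  ring

theorem deriv_ellTwo_sub {τ : ℂ} (hτ : 0 < τ.im) :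
    deriv ellTwo τ - deriv ellThree τ = 4 * (ellTwo τ - ellThree τ) * ellFour τ :=
  deriv_sub_of_eq_const_mul_pow_four hτ (differentiableAt_ellTwo hτ) (differentiableAt_ellThree hτ)
    (differentiableAt_thetaFour hτ) fun _ ht ↦ ellTwo_sub_ellThree ht

theorem deriv_ellThree_sub {τ : ℂ} (hτ : 0 < τ.im) :
    deriv ellThree τ - deriv ellFour τ = 4 * (ellThree τ - ellFour τ) * ellTwo τ :=
  deriv_sub_of_eq_const_mul_pow_four hτ (differentiableAt_ellThree hτ) (differentiableAt_ellFour hτ)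
    (differentiableAt_thetaTwo hτ) fun _ ht ↦ ellThree_sub_ellFour ht

/-- Under τ ↦ -1/τ, both the sum of derivatives and the doubled sum of products acquire 2τ³(ℓ₂ + ℓ₃
+ ℓ₄) + 3τ²/2, so the difference is modular of weight 4. Each product contains ℓ₃ or ℓ₄, hence tends
to 0. -/
theorem deriv_ell_sum {τ : ℂ} (hτ : 0 < τ.im) :
    deriv ellTwo τ + deriv ellThree τ + deriv ellFour τ
      - 2 * (ellTwo τ * ellThree τ + ellThree τ * ellFour τ + ellTwo τ * ellFour τ) = 0 := by
  refine eq_zero_of_levelOne (k := 4) (by norm_num)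
    (f := fun τ ↦ deriv ellTwo τ + deriv ellThree τ + deriv ellFour τ
      - 2 * (ellTwo τ * ellThree τ + ellThree τ * ellFour τ + ellTwo τ * ellFour τ))
    ?_ (fun τ hτ ↦ ?_) (fun τ hτ ↦ ?_) ?_ hτ
  · have h2 := differentiableOn_ellTwo
    have h3 := differentiableOn_ellThree
    have h4 := differentiableOn_ellFour
    exact (((h2.deriv isOpen_upper).add (h3.deriv isOpen_upper)).add (h4.deriv isOpen_upper)).sub
      (((h2.mul h3).add (h3.mul h4)).add (h2.mul h4) |>.const_mul 2)
  · simp only [ellTwo_add_one hτ, ellThree_add_one hτ, ellFour_add_one hτ,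
      deriv_add_one_of_eqOn hτ fun _ ↦ ellTwo_add_one,
      deriv_add_one_of_eqOn hτ fun _ ↦ ellThree_add_one,
      deriv_add_one_of_eqOn hτ fun _ ↦ ellFour_add_one]
    ring
  · have hτ' := im_neg_one_div_pos hτ
    simp only [ellTwo_neg_one_div hτ, ellThree_neg_one_div hτ, ellFour_neg_one_div hτ,
      deriv_neg_one_div_of_eqOn hτ (fun _ ↦ ellTwo_neg_one_div) (differentiableAt_ellTwo hτ')
        (differentiableAt_ellFour hτ),
      deriv_neg_one_div_of_eqOn hτ (fun _ ↦ ellThree_neg_one_div) (differentiableAt_ellThree hτ')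
        (differentiableAt_ellThree hτ),
      deriv_neg_one_div_of_eqOn hτ (fun _ ↦ ellFour_neg_one_div) (differentiableAt_ellFour hτ')
        (differentiableAt_ellTwo hτ)]
    norm_cast
    ring
  · have h2 := tendsto_ellTwo
    have h3 := tendsto_ellThree
    have h4 := tendsto_ellFour
    simpa using ((tendsto_deriv_imInfty differentiableOn_ellTwo h2).add
      (tendsto_deriv_imInfty differentiableOn_ellThree h3) |>.add
      (tendsto_deriv_imInfty differentiableOn_ellFour h4)).sub
      (((h2.mul h3).add (h3.mul h4)).add (h2.mul h4) |>.const_mul 2)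

theorem deriv_ellTwo {τ : ℂ} (hτ : 0 < τ.im) : deriv ellTwo τ
    = 2 * (ellTwo τ * ellThree τ + ellTwo τ * ellFour τ - ellThree τ * ellFour τ) := by
  linear_combination (deriv_ell_sum hτ + 2 * deriv_ellTwo_sub hτ + deriv_ellThree_sub hτ) / 3

theorem deriv_ellThree {τ : ℂ} (hτ : 0 < τ.im) : deriv ellThree τ
    = 2 * (ellThree τ * ellTwo τ + ellThree τ * ellFour τ - ellTwo τ * ellFour τ) := by
  linear_combination (deriv_ell_sum hτ - deriv_ellTwo_sub hτ + deriv_ellThree_sub hτ) / 3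

theorem deriv_ellFour {τ : ℂ} (hτ : 0 < τ.im) : deriv ellFour τ
    = 2 * (ellFour τ * ellTwo τ + ellFour τ * ellThree τ - ellTwo τ * ellThree τ) := by
  linear_combination (deriv_ell_sum hτ - deriv_ellTwo_sub hτ - 2 * deriv_ellThree_sub hτ) / 3

/-! ### Jacobi's equation from a Halphen system -/

/-- If the logarithmic derivative `q` of `y` belongs to a solution `p, q, r` of the Halphen system
and `16 (p - r)² = k y⁸`, then `y` satisfies Jacobi's third order differential equation. -/
theorem jacobi_ode_of_halphen {U : Set ℂ} (hU : IsOpen U) {y p q r : ℂ → ℂ} {k : ℂ}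
    (hy : ∀ z ∈ U, HasDerivAt y (y z * q z) z)
    (hp : ∀ z ∈ U, HasDerivAt p (2 * (p z * q z + p z * r z - q z * r z)) z)
    (hq : ∀ z ∈ U, HasDerivAt q (2 * (q z * p z + q z * r z - p z * r z)) z)
    (hr : ∀ z ∈ U, HasDerivAt r (2 * (r z * p z + r z * q z - p z * q z)) z)
    (hk : ∀ z ∈ U, 16 * (p z - r z) ^ 2 = k * y z ^ 8) {z : ℂ} (hz : z ∈ U) :
    (y z ^ 2 * iteratedDeriv 3 y z - 15 * y z * deriv y z * iteratedDeriv 2 y z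
          + 30 * deriv y z ^ 3) ^ 2
        + 32 * (y z * iteratedDeriv 2 y z - 3 * deriv y z ^ 2) ^ 3
      = k * y z ^ 10 * (y z * iteratedDeriv 2 y z - 3 * deriv y z ^ 2) ^ 2 := by
  have h1 : ∀ z ∈ U, deriv y z = y z * q z := fun z hz ↦ (hy z hz).deriv
  have h2 : ∀ z ∈ U, iteratedDeriv 2 y z
      = y z * (q z ^ 2 + 2 * (q z * p z + q z * r z - p z * r z)) := by
    intro z hz
    rw [iteratedDeriv_succ, iteratedDeriv_one,
      EventuallyEq.deriv_eq (eventually_of_mem (hU.mem_nhds hz) h1),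
      ((hy z hz).fun_mul (hq z hz)).deriv]
    ring
  have h3 : iteratedDeriv 3 y z = y z * (q z * (q z ^ 2 + 2 * (q z * p z + q z * r z - p z * r z))
      + (2 * q z + 2 * p z + 2 * r z) * (2 * (q z * p z + q z * r z - p z * r z))
      + (2 * q z - 2 * r z) * (2 * (p z * q z + p z * r z - q z * r z))
      + (2 * q z - 2 * p z) * (2 * (r z * p z + r z * q z - p z * q z))) := by
    have hp := hp z hz
    have hq := hq z hz
    have hr := hr z hz
    rw [iteratedDeriv_succ,
      EventuallyEq.deriv_eq (eventually_of_mem (hU.mem_nhds hz) h2),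
      ((hy z hz).fun_mul ((hq.fun_pow 2).fun_add ((((hq.fun_mul hp).fun_add (hq.fun_mul hr)).fun_sub
        (hp.fun_mul hr)).const_mul 2))).deriv]
    ring
  rw [h3, h2 z hz, h1 z hz]
  -- Here yy'' - 3y'² = -2y²(q - p)(q - r), and the cubic expression is 8y³(q - p)(q - r)(2q - p -
  -- r). The identity (2q - p - r)² - 4(q - p)(q - r) = (p - r)² then reduces the claim to `hk`.
  linear_combination 4 * (y z) ^ 6 * ((q z - p z) * (q z - r z)) ^ 2 * hk z hz

/-! ### Transfer to the unit disk -/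

/-- The Cayley transform from the unit disk to the upper half plane. -/
noncomputable def cayley (z : ℂ) : ℂ := Complex.I * ((1 - z) / (1 + z))

theorem one_add_mem_slitPlane {z : ℂ} (hz : ‖z‖ < 1) : 1 + z ∈ Complex.slitPlane :=
  Complex.mem_slitPlane_of_norm_lt_one hz

theorem im_cayley_pos {z : ℂ} (hz : ‖z‖ < 1) : 0 < (cayley z).im := by
  have h0 := Complex.slitPlane_ne_zero (one_add_mem_slitPlane hz)
  have h1 : 0 < Complex.normSq (1 + z) := Complex.normSq_pos.mpr h0
  have h2 : Complex.normSq z < 1 := by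
    rw [Complex.normSq_eq_norm_sq]
    nlinarith [norm_nonneg z]
  have h3 : (cayley z).im = (1 - Complex.normSq z) / Complex.normSq (1 + z) := by
    rw [cayley, Complex.I_mul_im, Complex.div_re, ← add_div]
    congr 1
    simp [Complex.normSq_apply]
    ring
  rw [h3]
  exact div_pos (by linarith) h1

theorem hasDerivAt_cayley {z : ℂ} (hz : ‖z‖ < 1) :
    HasDerivAt cayley (-2 * Complex.I / (1 + z) ^ 2) z := by
  have h0 := Complex.slitPlane_ne_zero (one_add_mem_slitPlane hz)
  refine ((((hasDerivAt_id z).const_sub 1).div ((hasDerivAt_id z).const_add 1) h0).const_mul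
    Complex.I).congr_deriv ?_
  simp only [id_eq]
  ring

theorem theta3_eq_thetaThree (x : ℂ) : theta3 x = thetaThree (Complex.I * x) := by
  refine tsum_congr fun n ↦ ?_
  rw [jacobiTheta₂_term]
  congr 1
  linear_combination -(Real.pi : ℂ) * n ^ 2 * x * Complex.I_sq

theorem sigma3_eq (z : ℂ) : sigma3 z = 1 / (1 + z) ^ (1 / 2 : ℂ) * thetaThree (cayley z) := by
  rw [sigma3, theta3_eq_thetaThree, cayley]

/-- The logarithmic derivative on the disk attached to a logarithmic derivative `L` of a form of
weight `1 / 2` on the upper half plane. -/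
noncomputable def diskLogDeriv (L : ℂ → ℂ) (z : ℂ) : ℂ :=
  -2 * Complex.I / (1 + z) ^ 2 * L (cayley z) - 1 / (2 * (1 + z))

/-- With γ the Cayley transform, `diskLogDeriv L` is γ'·(L ∘ γ) + γ''/(4γ'). The common shift
absorbs the derivative of γ', so the Halphen equation keeps its form. -/
theorem hasDerivAt_diskLogDeriv {L M N : ℂ → ℂ} {z : ℂ} (hz : ‖z‖ < 1)
    (hd : DifferentiableAt ℂ L (cayley z))
    (h : deriv L (cayley z) = 2 * (L (cayley z) * M (cayley z) + L (cayley z) * N (cayley z)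
      - M (cayley z) * N (cayley z))) :
    HasDerivAt (diskLogDeriv L) (2 * (diskLogDeriv L z * diskLogDeriv M z
      + diskLogDeriv L z * diskLogDeriv N z - diskLogDeriv M z * diskLogDeriv N z)) z := by
  have h0 := Complex.slitPlane_ne_zero (one_add_mem_slitPlane hz)
  have hadd : HasDerivAt (fun z : ℂ ↦ 1 + z) 1 z := (hasDerivAt_id z).const_add 1
  have h1 : HasDerivAt (fun z ↦ L (cayley z)) _ z := hd.hasDerivAt.comp z (hasDerivAt_cayley hz)
  have h2 := (((hasDerivAt_const z (-2 * Complex.I)).fun_div (hadd.fun_pow 2)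
    (pow_ne_zero 2 h0)).fun_mul h1).fun_sub ((hasDerivAt_const z (1 : ℂ)).fun_div
    (hadd.const_mul 2) (mul_ne_zero two_ne_zero h0))
  refine h2.congr_deriv ?_
  rw [h]
  simp only [diskLogDeriv]
  field_simp
  ring

theorem hasDerivAt_sigma3 {z : ℂ} (hz : ‖z‖ < 1) :
    HasDerivAt sigma3 (sigma3 z * diskLogDeriv ellThree z) z := by
  have hs := one_add_mem_slitPlane hz
  have h0 := Complex.slitPlane_ne_zero hs
  have hτ := im_cayley_pos hz
  have hadd : HasDerivAt (fun z : ℂ ↦ 1 + z) 1 z := (hasDerivAt_id z).const_add 1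
  have h1 : HasDerivAt (fun z ↦ thetaThree (cayley z)) _ z :=
    (differentiableAt_thetaThree hτ).hasDerivAt.comp z (hasDerivAt_cayley hz)
  have hc : (1 + z) ^ (1 / 2 : ℂ) ≠ 0 := by simp [Complex.cpow_eq_zero_iff, h0]
  have h2 := ((hasDerivAt_const z (1 : ℂ)).fun_div (hadd.cpow_const (c := 1 / 2) hs) hc).fun_mul h1
  rw [funext sigma3_eq]
  refine h2.congr_deriv ?_
  have h3 := (thetaTwo_thetaThree_thetaFour_ne_zero hτ).2.1
  have h4 : (1 + z) ^ (1 / 2 - 1 : ℂ) = (1 + z) ^ (1 / 2 : ℂ) / (1 + z) := by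
    rw [Complex.cpow_sub _ _ h0, Complex.cpow_one]
  rw [h4, diskLogDeriv, ellThree, logDeriv_apply]
  field_simp
  ring

/-- The shifts cancel, and (-2i)(πi/4) = π/2 makes the difference equal to (π/2)σ₃⁴. -/
theorem diskLogDeriv_sub_sq {z : ℂ} (hz : ‖z‖ < 1) :
    16 * (diskLogDeriv ellTwo z - diskLogDeriv ellFour z) ^ 2
      = 4 * (Real.pi : ℂ) ^ 2 * sigma3 z ^ 8 := by
  have h0 := Complex.slitPlane_ne_zero (one_add_mem_slitPlane hz)
  have h1 : diskLogDeriv ellTwo z - diskLogDeriv ellFour z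
      = -2 * Complex.I / (1 + z) ^ 2 * (ellTwo (cayley z) - ellFour (cayley z)) := by
    simp only [diskLogDeriv]
    ring
  have h2 : ((1 + z) ^ (1 / 2 : ℂ)) ^ 8 = (1 + z) ^ 4 := by
    rw [← Complex.cpow_nat_mul, ← Complex.cpow_natCast]
    norm_num
  rw [h1, ellTwo_sub_ellFour (im_cayley_pos hz), sigma3_eq, mul_pow (1 / _), div_pow, h2]
  field_simp
  linear_combination 64 * thetaThree (cayley z) ^ 8 * (Complex.I ^ 2 - 1) * Complex.I_sq

theorem mainTheorem6 :
    DifferentiableOn ℂ sigma3 (Metric.ball (0 : ℂ) 1) ∧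
      ∀ z : ℂ, ‖z‖ < 1 →
        ((sigma3 z) ^ 2 * iteratedDeriv 3 sigma3 z
            - 15 * sigma3 z * deriv sigma3 z * iteratedDeriv 2 sigma3 z
            + 30 * (deriv sigma3 z) ^ 3) ^ 2
          + 32 * (sigma3 z * iteratedDeriv 2 sigma3 z - 3 * (deriv sigma3 z) ^ 2) ^ 3
        = 4 * (Real.pi : ℂ) ^ 2 * (sigma3 z) ^ 10
            * (sigma3 z * iteratedDeriv 2 sigma3 z - 3 * (deriv sigma3 z) ^ 2) ^ 2 := by
  refine ⟨fun z hz ↦ (hasDerivAt_sigma3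
    (mem_ball_zero_iff.mp hz)).differentiableAt.differentiableWithinAt, fun z hz ↦ ?_⟩
  refine jacobi_ode_of_halphen (U := Metric.ball 0 1) (p := diskLogDeriv ellTwo)
    (q := diskLogDeriv ellThree) (r := diskLogDeriv ellFour) Metric.isOpen_ball ?_ ?_ ?_ ?_ ?_
    (mem_ball_zero_iff.mpr hz) <;> intro w hw <;> rw [mem_ball_zero_iff] at hw <;>
    have hτ := im_cayley_pos hw
  · exact hasDerivAt_sigma3 hw
  · exact hasDerivAt_diskLogDeriv hw (differentiableAt_ellTwo hτ) (deriv_ellTwo hτ)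
  · exact hasDerivAt_diskLogDeriv hw (differentiableAt_ellThree hτ) (deriv_ellThree hτ)
  · exact hasDerivAt_diskLogDeriv hw (differentiableAt_ellFour hτ) (deriv_ellFour hτ)
  · exact diskLogDeriv_sub_sq hw
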